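/- Let $U\subseteq\mathbb{R}^n$ be bounded and open. For $v:\overline U\to\mathbb{R}^m$ and $x\in U$ let $$\mathrm{L}v(x)=\inf_{r>0}\ \sup_{y\ne z\,\in\, U\cap B_r(x)}\frac{|v(y)-v(z)|}{|y-z|}$$ be the local Lipschitz constant (a supremum over an empty set being $0$). If $u,v:\overline U\to\mathbb{R}^m$ are Lipschitz, then $v$ is called tighter than $u$ if $u=v$ on $\partial U$ and $$\sup\{\mathrm{L}u(x): x\in U,\ \mathrm{L}v(x)<\mathrm{L}u(x)\}>\sup\{\mathrm{L}v(x): x\in U,\ \mathrm{L}v(x)>\mathrm{L}u(x)\};$$ a Lipschitz function $u$ is called tight if no $v$ is tighter than $u$. A principal direction field for $u\in C^1(U,\mathbb{R}^m)$ is a continuous unit vector field $a:U\to\mathbb{R}^n$ such that, for every $x\in U$, $a(x)$ spans the eigenspace of $Du(x)^tDu(x)$ belonging to its largest eigenvalue. A continuous function $f:U\to\mathbb{R}$ is called infinity harmonic if it is a viscosity solution of $-\Delta_\infty f=0$ in $U$, where $\Delta_\infty\varphi=|D\varphi|^{-2}\sum_{i,j}\varphi_{x_i}\varphi_{x_j}\varphi_{x_ix_j}$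 (read as $0$ where $D\varphi=0$). The flow curves of $f\in C^\infty(U,\mathbb{R})$ are the integral curves in $U$ of its gradient field $Df$. Proposition. Suppose $u:\overline U\to\mathbb{R}^m$ is Lipschitz, $u\in C^\infty(U,\mathbb{R}^m)$, and $u$ has the form $$u(x)=f(x)b(x)+c(x)\qquad(x\in U),$$ where 1. the function $f\in C^\infty(U,\mathbb{R})$ is infinity harmonic; 2. the unit vector field $b\in C^\infty(U,\mathbb{R}^m)$ is constant on each flow curve of $f$; 3. the vector field $c\in C^\infty(U,\mathbb{R}^m)$ is constant on each flow curve of $f$; 4. the vector field $a:=|Df|^{-1}Df$ is (well defined on $U$ and) a principal direction field for $u$. Then $u$ is tight. -/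

import Mathlib

open Set Topology
open scoped ENNReal NNReal ContDiff Gradient

noncomputable section

/-- `Lip(f, X) = sup_{x, y ∈ X} |f x - f y| / |x - y|`, valued in `[0, ∞]`
(in `ℝ≥0∞` one has `0 / 0 = 0`, so the diagonal contributes nothing). -/
def lipConst {n m : ℕ} (f : EuclideanSpace ℝ (Fin n) → EuclideanSpace ℝ (Fin m))
    (X : Set (EuclideanSpace ℝ (Fin n))) : ℝ≥0∞ :=
  ⨆ x ∈ X, ⨆ y ∈ X, edist (f x) (f y) / edist x y

/-- The local Lipschitz constant `L u (x) = inf_{r > 0} Lip(u, U ∩ B_r(x))`. -/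
def localLip {n m : ℕ} (U : Set (EuclideanSpace ℝ (Fin n)))
    (u : EuclideanSpace ℝ (Fin n) → EuclideanSpace ℝ (Fin m))
    (x : EuclideanSpace ℝ (Fin n)) : ℝ≥0∞ :=
  ⨅ r : ℝ, ⨅ _ : 0 < r, lipConst u (U ∩ Metric.ball x r)

/-- `u` is Lipschitz on the closure of `U`. -/
def IsLipschitzOnClosure {n m : ℕ} (U : Set (EuclideanSpace ℝ (Fin n)))
    (u : EuclideanSpace ℝ (Fin n) → EuclideanSpace ℝ (Fin m)) : Prop :=
  ∃ K : ℝ≥0, LipschitzOnWith K u (closure U)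

/-- `v` is tighter than `u` on `U`: both are Lipschitz on `closure U`, they agree on the boundary,
and `sup {L u : L v < L u} > sup {L v : L v > L u}`, the suprema being over points of `U`.
(All values are nonnegative and the supremum of the empty set is `0`.) -/
def IsTighter {n m : ℕ} (U : Set (EuclideanSpace ℝ (Fin n)))
    (v u : EuclideanSpace ℝ (Fin n) → EuclideanSpace ℝ (Fin m)) : Prop :=
  IsLipschitzOnClosure U u ∧ IsLipschitzOnClosure U v ∧ EqOn u v (frontier U) ∧
    sSup (localLip U v '' {x ∈ U | localLip U u x < localLip U v x}) <
      sSup (localLip U u '' {x ∈ U | localLip U v x < localLip U u x})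

/-- A function that is Lipschitz on `closure U` is tight if no function is tighter. -/
def IsTight {n m : ℕ} (U : Set (EuclideanSpace ℝ (Fin n)))
    (u : EuclideanSpace ℝ (Fin n) → EuclideanSpace ℝ (Fin m)) : Prop :=
  IsLipschitzOnClosure U u ∧
    ¬ ∃ v : EuclideanSpace ℝ (Fin n) → EuclideanSpace ℝ (Fin m), IsTighter U v u

/-- The infinity Laplacian `Δ_∞ φ = |Dφ|⁻² φ_{x_i} φ_{x_j} φ_{x_i x_j}`. -/
def infinityLaplacian {n : ℕ} (φ : EuclideanSpace ℝ (Fin n) → ℝ)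
    (x : EuclideanSpace ℝ (Fin n)) : ℝ :=
  (‖∇ φ x‖ ^ 2)⁻¹ * fderiv ℝ (fderiv ℝ φ) x (∇ φ x) (∇ φ x)

/-- `f` is infinity harmonic in `U`: a viscosity solution of `- Δ_∞ f = 0` in `U`.
(At points where the gradient of the test function vanishes nothing is required.) -/
def IsInfinityHarmonic {n : ℕ} (U : Set (EuclideanSpace ℝ (Fin n)))
    (f : EuclideanSpace ℝ (Fin n) → ℝ) : Prop :=
  ContinuousOn f U ∧
    ∀ φ : EuclideanSpace ℝ (Fin n) → ℝ, ContDiffOn ℝ 2 φ U → ∀ x ∈ U,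
      (IsLocalMax (fun y => f y - φ y) x → - infinityLaplacian φ x ≤ 0) ∧
      (IsLocalMin (fun y => f y - φ y) x → 0 ≤ - infinityLaplacian φ x)

/-- `γ`, restricted to the open interval `(s, t)`, is an (arc of a) flow curve of `f` in `U`:
an integral curve of the gradient field `Df` that stays in `U`. -/
def IsFlowCurve {n : ℕ} (U : Set (EuclideanSpace ℝ (Fin n)))
    (f : EuclideanSpace ℝ (Fin n) → ℝ) (γ : ℝ → EuclideanSpace ℝ (Fin n)) (s t : ℝ) : Prop :=
  ∀ τ ∈ Ioo s t, γ τ ∈ U ∧ HasDerivAt γ (∇ f (γ τ)) τ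

/-- `g` is constant on each flow curve of `f` in `U`. -/
def IsConstantOnFlowCurves {n m : ℕ} (U : Set (EuclideanSpace ℝ (Fin n)))
    (f : EuclideanSpace ℝ (Fin n) → ℝ)
    (g : EuclideanSpace ℝ (Fin n) → EuclideanSpace ℝ (Fin m)) : Prop :=
  ∀ (γ : ℝ → EuclideanSpace ℝ (Fin n)) (s t : ℝ), IsFlowCurve U f γ s t →
    ∀ τ₁ ∈ Ioo s t, ∀ τ₂ ∈ Ioo s t, g (γ τ₁) = g (γ τ₂)

/-- The operator `Du(x)ᵗ Du(x)` on `ℝⁿ`. -/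
def gramOperator {n m : ℕ} (u : EuclideanSpace ℝ (Fin n) → EuclideanSpace ℝ (Fin m))
    (x : EuclideanSpace ℝ (Fin n)) : Module.End ℝ (EuclideanSpace ℝ (Fin n)) :=
  ((ContinuousLinearMap.adjoint (fderiv ℝ u x)).comp (fderiv ℝ u x) :
    EuclideanSpace ℝ (Fin n) →L[ℝ] EuclideanSpace ℝ (Fin n)).toLinearMap

/-- `a` is a principal direction field for `u ∈ C¹(U)`: a continuous unit vector field on `U` such
that `a x` spans the eigenspace of `Du(x)ᵗ Du(x)` belonging to its largest eigenvalue, for each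
`x ∈ U`. -/
def IsPrincipalDirectionField {n m : ℕ} (U : Set (EuclideanSpace ℝ (Fin n)))
    (u : EuclideanSpace ℝ (Fin n) → EuclideanSpace ℝ (Fin m))
    (a : EuclideanSpace ℝ (Fin n) → EuclideanSpace ℝ (Fin n)) : Prop :=
  ContDiffOn ℝ 1 u U ∧ ContinuousOn a U ∧ ∀ x ∈ U, ‖a x‖ = 1 ∧
    ∃ μ : ℝ, IsGreatest {ν : ℝ | (gramOperator u x).HasEigenvalue ν} μ ∧
      (gramOperator u x).eigenspace μ = Submodule.span ℝ {a x}

end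

/-!
The function `u = f b + c` moves along a straight line while its argument follows a flow curve of
`f`. Indeed, `b` and `c` are constant there, and so is the slope `|Df|`, because the smooth function
`f` satisfies `D²f(Df, Df) = 0` (`IsFlowCurve.norm_gradient_eq`). Moreover `|Df|` bounds the local
Lipschitz constant of `u`: differentiating `u` along the flow gives `Du (Df) = |Df|² b`, and the
direction of `Df` realises the operator norm of `Du` (`localLip_le_norm_gradient`). On a flow curve
of slope `λ`, therefore, `u` already changes at rate `λ` in arclength, without any slack.

Suppose that `v` agrees with `u` on the boundary and `Lv(x) < Lu(x)` at a point of slope `λ`. The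
flow curve through `x` leads to the boundary in both directions, since `f` increases at the fixed
rate `λ²` and is bounded along it. If `Lv ≤ λ` held on the whole curve, then `v` would change along
it at rate at most `λ`, and strictly less near `x`, so it could not reach the boundary values of
`u`. Hence `Lv(y) > λ ≥ Lu(y)` for some `y` on the curve (`exists_norm_gradient_lt_localLip`), and
the supremum of `Lv` over `{Lv > Lu}` is at least that of `Lu` over `{Lv < Lu}`.

Maximal flow curves and their endpoints are not needed. Flow arcs starting in a compact part of `U`
have a uniform duration (`IsCompact.exists_forall_integralCurve_mem`), so a finite chain of arcs
gets within any prescribed distance of the boundary (`exists_flowLinked_infDist_compl_lt`). The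
resulting error is made smaller than the strict gain near `x`.
-/

/-! ### Local Lipschitz constants -/

theorem exists_ball_norm_sub_le_of_localLip_lt {n m : ℕ} {U : Set (EuclideanSpace ℝ (Fin n))}
    {v : EuclideanSpace ℝ (Fin n) → EuclideanSpace ℝ (Fin m)} {x : EuclideanSpace ℝ (Fin n)}
    {L : ℝ} (hL : 0 ≤ L) (h : localLip U v x < ENNReal.ofReal L) :
    ∃ r > 0, ∀ y ∈ U ∩ Metric.ball x r, ∀ z ∈ U ∩ Metric.ball x r,
      ‖v y - v z‖ ≤ L * ‖y - z‖ := by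
  obtain ⟨r, hr⟩ := iInf_lt_iff.1 h
  obtain ⟨hr0, hr⟩ := iInf_lt_iff.1 hr
  refine ⟨r, hr0, fun y hy z hz => ?_⟩
  rcases eq_or_ne y z with rfl | hne
  · simp
  have h1 : edist (v y) (v z) / edist y z ≤ ENNReal.ofReal L :=
    (le_iSup₂_of_le (f := fun y (_ : y ∈ U ∩ Metric.ball x r) =>
        ⨆ z ∈ U ∩ Metric.ball x r, edist (v y) (v z) / edist y z) y hy
      (le_iSup₂_of_le z hz le_rfl)).trans hr.le
  have h2 := (ENNReal.div_le_iff (edist_pos.2 hne).ne' (edist_ne_top _ _)).1 h1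
  rwa [edist_dist, edist_dist, ← ENNReal.ofReal_mul hL,
    ENNReal.ofReal_le_ofReal_iff (by positivity), dist_eq_norm, dist_eq_norm] at h2

theorem localLip_le_of_contDiffAt {n m : ℕ} {U : Set (EuclideanSpace ℝ (Fin n))}
    {u : EuclideanSpace ℝ (Fin n) → EuclideanSpace ℝ (Fin m)} {x : EuclideanSpace ℝ (Fin n)}
    (hu : ContDiffAt ℝ 1 u x) : localLip U u x ≤ ENNReal.ofReal ‖fderiv ℝ u x‖ := by
  rw [ofReal_norm, enorm]
  refine ENNReal.le_of_forall_pos_le_add fun ε hε _ => ?_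
  obtain ⟨s, hs, hLip⟩ :=
    (hu.hasStrictFDerivAt one_ne_zero).exists_lipschitzOnWith_of_nnnorm_lt
      (‖fderiv ℝ u x‖₊ + ε) (lt_add_of_pos_right _ hε)
  obtain ⟨r, hr, hrs⟩ := Metric.mem_nhds_iff.1 hs
  refine iInf₂_le_of_le r hr (iSup₂_le fun y hy => iSup₂_le fun z hz => ?_)
  exact ENNReal.div_le_of_le_mul (by exact_mod_cast hLip (hrs hy.2) (hrs hz.2))

/-- Along a curve in `U` of speed at most `A` on which the local Lipschitz constant of `v` is at
most `L`, the function `v` has Lipschitz constant at most `L * A` in the time parameter. -/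
theorem norm_sub_le_of_localLip_le_of_norm_deriv_le {n m : ℕ}
    {U : Set (EuclideanSpace ℝ (Fin n))}
    {v : EuclideanSpace ℝ (Fin n) → EuclideanSpace ℝ (Fin m)} (hv : ContinuousOn v U)
    {γ γ' : ℝ → EuclideanSpace ℝ (Fin n)} {s t L A : ℝ} (hst : s ≤ t) (hL : 0 ≤ L) (hA : 0 < A)
    (hU : ∀ τ ∈ Icc s t, γ τ ∈ U) (hγ : ∀ τ ∈ Icc s t, HasDerivAt γ (γ' τ) τ)
    (hγ' : ∀ τ ∈ Icc s t, ‖γ' τ‖ ≤ A)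
    (hvL : ∀ τ ∈ Icc s t, localLip U v (γ τ) ≤ ENNReal.ofReal L) :
    ‖v (γ t) - v (γ s)‖ ≤ L * A * (t - s) := by
  have hspeed : ∀ p ∈ Icc s t, ∀ q ∈ Icc s t, ‖γ q - γ p‖ ≤ A * ‖q - p‖ := fun p hp q hq =>
    (convex_Icc s t).norm_image_sub_le_of_norm_hasDerivWithin_le
      (fun τ hτ => (hγ τ hτ).hasDerivWithinAt) hγ' hp hq
  have hcont : ContinuousOn (fun τ => v (γ τ) - v (γ s)) (Icc s t) :=
    (hv.comp (fun τ hτ => (hγ τ hτ).continuousAt.continuousWithinAt) hU).sub continuousOn_const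
  -- The fencing inequality needs a strict bound, so compare with slopes `M > L * A` first.
  have key : ∀ M > L * A, ‖v (γ t) - v (γ s)‖ ≤ M * (t - s) := by
    intro M hM
    refine image_norm_le_of_liminf_right_slope_norm_lt_deriv_boundary
      (f := fun τ => v (γ τ) - v (γ s)) (f' := fun _ => L * A) (B := fun τ => M * (τ - s))
      (B' := fun _ => M) hcont ?_ (by simp) (by fun_prop) ?_ (fun _ _ _ => hM) (right_mem_Icc.2 hst)
    · intro x hx r hr
      have hx' := Ico_subset_Icc_self hx
      obtain ⟨L', hLL', hL'r⟩ := exists_between ((lt_div_iff₀ hA).2 hr)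
      have hL' : 0 < L' := hL.trans_lt hLL'
      obtain ⟨ρ, hρ, hball⟩ := exists_ball_norm_sub_le_of_localLip_lt hL'.le
        ((hvL x hx').trans_lt ((ENNReal.ofReal_lt_ofReal_iff hL').2 hLL'))
      have h1 : ∀ᶠ z in 𝓝[>] x, γ z ∈ Metric.ball (γ x) ρ :=
        nhdsWithin_le_nhds ((hγ x hx').continuousAt (Metric.ball_mem_nhds _ hρ))
      have h2 : ∀ᶠ z in 𝓝[>] x, z ∈ Ioo x t := Ioo_mem_nhdsGT hx.2
      refine (h1.and h2).frequently.mono ?_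
      rintro z ⟨hz1, hz2⟩
      have hz' : z ∈ Icc s t := ⟨hx.1.trans hz2.1.le, hz2.2.le⟩
      have hzx : 0 < z - x := sub_pos.2 hz2.1
      have e1 := hball (γ z) ⟨hU z hz', hz1⟩ (γ x) ⟨hU x hx', Metric.mem_ball_self hρ⟩
      have e2 := hspeed x hx' z hz'
      rw [Real.norm_of_nonneg hzx.le] at e2
      have e3 := norm_sub_norm_le (v (γ z) - v (γ s)) (v (γ x) - v (γ s))
      rw [sub_sub_sub_cancel_right] at e3
      rw [slope_def_field, div_lt_iff₀ hzx]
      calc ‖v (γ z) - v (γ s)‖ - ‖v (γ x) - v (γ s)‖ ≤ L' * (A * (z - x)) :=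
            e3.trans (e1.trans (by gcongr))
        _ = L' * A * (z - x) := by ring
        _ < r * (z - x) := by gcongr; exact (lt_div_iff₀ hA).1 hL'r
    · intro x _
      have := ((hasDerivAt_id x).sub_const s).const_mul M
      simpa using this.hasDerivWithinAt
  refine le_of_forall_pos_le_add fun ε hε => ?_
  have hpos : 0 < t - s + 1 := by linarith
  refine (key (L * A + ε / (t - s + 1)) (by linarith [div_pos hε hpos])).trans ?_
  have : ε / (t - s + 1) * (t - s) ≤ ε := by
    rw [div_mul_eq_mul_div, div_le_iff₀ hpos]; nlinarith
  linarith

/-! ### Principal directions -/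

/-- A vector spanning the eigenspace of `Du(x)ᵗ Du(x)` for the largest eigenvalue realises the
operator norm of `Du(x)`. -/
theorem norm_fderiv_le_of_eigenspace_eq_span {n m : ℕ}
    {u : EuclideanSpace ℝ (Fin n) → EuclideanSpace ℝ (Fin m)} {x e : EuclideanSpace ℝ (Fin n)}
    (he : ‖e‖ = 1) {μ : ℝ} (hμ : IsGreatest {ν : ℝ | (gramOperator u x).HasEigenvalue ν} μ)
    (hspan : (gramOperator u x).eigenspace μ = Submodule.span ℝ {e}) :
    ‖fderiv ℝ u x‖ ≤ ‖fderiv ℝ u x e‖ := by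
  have hgram : ∀ w z, inner ℝ (gramOperator u x w) z =
      inner ℝ (fderiv ℝ u x w) (fderiv ℝ u x z) := by
    intro w z
    change inner ℝ ((fderiv ℝ u x).adjoint (fderiv ℝ u x w)) z = _
    rw [ContinuousLinearMap.adjoint_inner_left]
  have hsymm : (gramOperator u x).IsSymmetric := fun w z => by
    rw [hgram, ← real_inner_comm w, hgram, real_inner_comm]
  have hne : e ≠ 0 := fun h => by simp [h] at he
  have : Nontrivial (EuclideanSpace ℝ (Fin n)) := nontrivial_of_ne e 0 hne
  have hemem : e ∈ (gramOperator u x).eigenspace μ := hspan ▸ Submodule.mem_span_singleton_self e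
  have hμe : μ = ‖fderiv ℝ u x e‖ ^ 2 := by
    rw [← real_inner_self_eq_norm_sq, ← hgram, Module.End.mem_eigenspace_iff.1 hemem,
      real_inner_smul_left, real_inner_self_eq_norm_sq, he]
    norm_num
  have hsup : (⨆ w : {w : EuclideanSpace ℝ (Fin n) // w ≠ 0}, inner ℝ (gramOperator u x w)
      (w : EuclideanSpace ℝ (Fin n)) / ‖(w : EuclideanSpace ℝ (Fin n))‖ ^ 2) ≤ μ :=
    hμ.2 (by
      have h := hsymm.hasEigenvalue_iSup_of_finiteDimensional
      exact h)
  have hbdd : BddAbove (range fun w : {w : EuclideanSpace ℝ (Fin n) // w ≠ 0} =>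
      inner ℝ (gramOperator u x w) (w : EuclideanSpace ℝ (Fin n)) /
        ‖(w : EuclideanSpace ℝ (Fin n))‖ ^ 2) := by
    refine ⟨‖fderiv ℝ u x‖ ^ 2, ?_⟩
    rintro _ ⟨w, rfl⟩
    have hw : 0 < ‖(w : EuclideanSpace ℝ (Fin n))‖ := norm_pos_iff.2 w.2
    simp only
    rw [hgram, real_inner_self_eq_norm_sq, div_le_iff₀ (by positivity), ← mul_pow]
    gcongr
    exact (fderiv ℝ u x).le_opNorm _
  refine ContinuousLinearMap.opNorm_le_bound _ (norm_nonneg _) fun w => ?_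
  rcases eq_or_ne w 0 with rfl | hw
  · simp
  have hw' : 0 < ‖w‖ := norm_pos_iff.2 hw
  have h1 := (le_ciSup hbdd ⟨w, hw⟩).trans hsup
  simp only at h1
  rw [hgram, real_inner_self_eq_norm_sq, hμe, div_le_iff₀ (by positivity), ← mul_pow] at h1
  exact le_of_sq_le_sq h1 (by positivity)

/-! ### Integral curves of uniform duration -/

theorem ContDiffAt.exists_nhds_forall_integralCurve_mem {E : Type*} [NormedAddCommGroup E]
    [NormedSpace ℝ E] [CompleteSpace E] {V : E → E} {x₀ : E} (hV : ContDiffAt ℝ 1 V x₀)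
    {W : Set E} (hW : W ∈ 𝓝 x₀) :
    ∃ S ∈ 𝓝 x₀, ∃ τ > 0, ∀ x ∈ S, ∃ γ : ℝ → E, γ 0 = x ∧
      ∀ t ∈ Ioo (-τ) τ, γ t ∈ W ∧ HasDerivAt γ (V (γ t)) t := by
  obtain ⟨ε, hε, a, r, _, _, hr, hpl⟩ := IsPicardLindelof.of_contDiffAt_one hV
  obtain ⟨α, hα, hcont⟩ := (hpl 0).exists_forall_mem_closedBall_eq_hasDerivWithinAt_continuousOn
  have hr' : (0 : ℝ) < r := hr
  have hdom : Metric.closedBall x₀ (r : ℝ) ×ˢ Icc (0 - ε) (0 + ε) ∈ 𝓝 (x₀, (0 : ℝ)) :=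
    prod_mem_nhds (Metric.closedBall_mem_nhds _ hr') (Icc_mem_nhds (by linarith) (by linarith))
  have h0 : α (x₀, 0) = x₀ := (hα x₀ (Metric.mem_closedBall_self hr'.le)).1
  have hpre : α ⁻¹' W ∈ 𝓝 (x₀, (0 : ℝ)) := (hcont.continuousAt hdom) (by rwa [h0])
  obtain ⟨S, hS, T, hT, hST⟩ := mem_nhds_prod_iff.1 hpre
  obtain ⟨δ, hδ, hδT⟩ := Metric.mem_nhds_iff.1 hT
  refine ⟨S ∩ Metric.closedBall x₀ r, Filter.inter_mem hS (Metric.closedBall_mem_nhds _ hr'),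
    min δ ε, lt_min hδ hε, fun x hx => ⟨fun t => α (x, t), (hα x hx.2).1, fun t ht => ⟨?_, ?_⟩⟩⟩
  · refine hST ⟨hx.1, hδT ?_⟩
    rw [Metric.mem_ball, dist_zero_right, Real.norm_eq_abs, abs_lt]
    exact ⟨(neg_le_neg (min_le_left _ _)).trans_lt ht.1, ht.2.trans_le (min_le_left _ _)⟩
  · have h1 := ht.1
    have h2 := ht.2
    have h3 := min_le_right δ ε
    exact ((hα x hx.2).2 t ⟨by linarith, by linarith⟩).hasDerivAt
      (Icc_mem_nhds (by linarith) (by linarith))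

theorem IsCompact.exists_forall_integralCurve_mem {E : Type*} [NormedAddCommGroup E]
    [NormedSpace ℝ E] [CompleteSpace E] {V : E → E} {K W : Set E} (hK : IsCompact K)
    (hW : IsOpen W) (hKW : K ⊆ W) (hV : ContDiffOn ℝ 1 V W) :
    ∃ τ > 0, ∀ x ∈ K, ∃ γ : ℝ → E, γ 0 = x ∧
      ∀ t ∈ Ioo (-τ) τ, γ t ∈ W ∧ HasDerivAt γ (V (γ t)) t := by
  refine hK.induction_on (p := fun S => ∃ τ > 0, ∀ x ∈ S, ∃ γ : ℝ → E, γ 0 = x ∧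
      ∀ t ∈ Ioo (-τ) τ, γ t ∈ W ∧ HasDerivAt γ (V (γ t)) t) ⟨1, one_pos, by simp⟩ ?_ ?_ ?_
  · rintro s t hst ⟨τ, hτ, h⟩
    exact ⟨τ, hτ, fun x hx => h x (hst hx)⟩
  · rintro s t ⟨τ, hτ, h⟩ ⟨τ', hτ', h'⟩
    refine ⟨min τ τ', lt_min hτ hτ', ?_⟩
    rintro x (hx | hx)
    · obtain ⟨γ, h0, hγ⟩ := h x hx
      exact ⟨γ, h0, fun t ht => hγ t (Ioo_subset_Ioo (neg_le_neg (min_le_left _ _))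
        (min_le_left _ _) ht)⟩
    · obtain ⟨γ, h0, hγ⟩ := h' x hx
      exact ⟨γ, h0, fun t ht => hγ t (Ioo_subset_Ioo (neg_le_neg (min_le_right _ _))
        (min_le_right _ _) ht)⟩
  · intro x hx
    have hxW := hW.mem_nhds (hKW hx)
    obtain ⟨S, hS, h⟩ := (hV.contDiffAt hxW).exists_nhds_forall_integralCurve_mem hxW
    exact ⟨S, nhdsWithin_le_nhds hS, h⟩

/-! ### Flow curves of a smooth infinity harmonic function -/

theorem ContDiffOn.gradient_of_isOpen {E : Type*} [NormedAddCommGroup E]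
    [InnerProductSpace ℝ E] [CompleteSpace E] {f : E → ℝ} {U : Set E} (hf : ContDiffOn ℝ 2 f U)
    (hU : IsOpen U) : ContDiffOn ℝ 1 (∇ f) U :=
  (InnerProductSpace.toDual ℝ E).symm.contDiff.comp_contDiffOn
    (hf.fderiv_of_isOpen hU (by norm_num))

/-- A `C²` infinity harmonic function solves `Δ_∞ f = 0` pointwise: it is its own test function. -/
theorem IsInfinityHarmonic.infinityLaplacian_eq_zero {n : ℕ} {U : Set (EuclideanSpace ℝ (Fin n))}
    {f : EuclideanSpace ℝ (Fin n) → ℝ} (h : IsInfinityHarmonic U f) (hf : ContDiffOn ℝ 2 f U)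
    {x : EuclideanSpace ℝ (Fin n)} (hx : x ∈ U) : infinityLaplacian f x = 0 := by
  obtain ⟨h1, h2⟩ := h.2 f hf x hx
  have h1 := h1 (by simp [IsLocalMax, IsMaxFilter])
  have h2 := h2 (by simp [IsLocalMin, IsMinFilter])
  linarith

theorem eqOn_Ioo_of_hasDerivAt_zero {G : Type*} [NormedAddCommGroup G] [NormedSpace ℝ G]
    {g : ℝ → G} {s t : ℝ} (h : ∀ τ ∈ Ioo s t, HasDerivAt g 0 τ) {p q : ℝ} (hp : p ∈ Ioo s t)
    (hq : q ∈ Ioo s t) : g p = g q :=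
  isOpen_Ioo.is_const_of_deriv_eq_zero isPreconnected_Ioo
    (fun τ hτ => (h τ hτ).differentiableAt.differentiableWithinAt) (fun τ hτ => (h τ hτ).deriv) hp hq

/-- The slope of a smooth infinity harmonic function is constant along its flow curves, since
`d/dt |Df|² = 2 D²f(Df, Df)` there. -/
theorem IsFlowCurve.norm_gradient_eq {n : ℕ} {U : Set (EuclideanSpace ℝ (Fin n))} (hU : IsOpen U)
    {f : EuclideanSpace ℝ (Fin n) → ℝ} (hf : ContDiffOn ℝ 2 f U) (hharm : IsInfinityHarmonic U f)
    {γ : ℝ → EuclideanSpace ℝ (Fin n)} {s t : ℝ} (hγ : IsFlowCurve U f γ s t) {p q : ℝ}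
    (hp : p ∈ Ioo s t) (hq : q ∈ Ioo s t) : ‖∇ f (γ p)‖ = ‖∇ f (γ q)‖ := by
  suffices h : ‖∇ f (γ p)‖ ^ 2 = ‖∇ f (γ q)‖ ^ 2 by
    exact (pow_left_inj₀ (norm_nonneg _) (norm_nonneg _) two_ne_zero).1 h
  refine eqOn_Ioo_of_hasDerivAt_zero (g := fun τ => ‖∇ f (γ τ)‖ ^ 2) (fun τ hτ => ?_) hp hq
  obtain ⟨hτU, hτγ⟩ := hγ τ hτ
  have hH : HasFDerivAt (fderiv ℝ f) (fderiv ℝ (fderiv ℝ f) (γ τ)) (γ τ) :=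
    (((hf.fderiv_of_isOpen hU (m := 1) (by norm_num)).contDiffAt
      (hU.mem_nhds hτU)).differentiableAt one_ne_zero).hasFDerivAt
  have hG : HasDerivAt (fun τ => ∇ f (γ τ)) ((InnerProductSpace.toDual ℝ _).symm
      (fderiv ℝ (fderiv ℝ f) (γ τ) (∇ f (γ τ)))) τ :=
    (InnerProductSpace.toDual ℝ (EuclideanSpace ℝ (Fin n))).symm.toContinuousLinearEquiv
      |>.hasFDerivAt.comp_hasDerivAt τ (hH.comp_hasDerivAt τ hτγ)
  refine hG.norm_sq.congr_deriv ?_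
  rw [real_inner_comm, InnerProductSpace.toDual_symm_apply]
  rcases eq_or_ne (∇ f (γ τ)) 0 with h0 | h0
  · simp [h0]
  · have := hharm.infinityLaplacian_eq_zero hf hτU
    rw [infinityLaplacian, mul_eq_zero, inv_eq_zero] at this
    simp [this.resolve_left (by simpa using h0)]

theorem IsFlowCurve.apply_sub_apply {n : ℕ} {U : Set (EuclideanSpace ℝ (Fin n))} (hU : IsOpen U)
    {f : EuclideanSpace ℝ (Fin n) → ℝ} (hf : ContDiffOn ℝ 2 f U) (hharm : IsInfinityHarmonic U f)
    {γ : ℝ → EuclideanSpace ℝ (Fin n)} {s t : ℝ} (hγ : IsFlowCurve U f γ s t) {p q r : ℝ}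
    (hp : p ∈ Ioo s t) (hq : q ∈ Ioo s t) (hr : r ∈ Ioo s t) :
    f (γ q) - f (γ p) = ‖∇ f (γ r)‖ ^ 2 * (q - p) := by
  have h := eqOn_Ioo_of_hasDerivAt_zero (g := fun τ => f (γ τ) - ‖∇ f (γ r)‖ ^ 2 * τ)
    (fun τ hτ => ?_) hp hq
  · linarith
  obtain ⟨hτU, hτγ⟩ := hγ τ hτ
  have hd : DifferentiableAt ℝ f (γ τ) :=
    (hf.contDiffAt (hU.mem_nhds hτU)).differentiableAt two_ne_zero
  have h1 := (hd.hasFDerivAt.comp_hasDerivAt τ hτγ).sub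
    ((hasDerivAt_id τ).const_mul (‖∇ f (γ r)‖ ^ 2))
  refine h1.congr_deriv ?_
  rw [← inner_gradient_left, real_inner_self_eq_norm_sq, hγ.norm_gradient_eq hU hf hharm hτ hr]
  simp

/-- If `u = f b + c` with `b`, `c` constant along the flow curves of `f`, then `Du (Df) = |Df|² b`:
differentiate `u` along the flow curve through the point. -/
theorem fderiv_apply_gradient {n m : ℕ} {U : Set (EuclideanSpace ℝ (Fin n))} (hU : IsOpen U)
    {u b c : EuclideanSpace ℝ (Fin n) → EuclideanSpace ℝ (Fin m)}
    {f : EuclideanSpace ℝ (Fin n) → ℝ} (hf : ContDiffOn ℝ 2 f U)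
    (hu : DifferentiableOn ℝ u U) (hform : ∀ x ∈ U, u x = f x • b x + c x)
    (hb : IsConstantOnFlowCurves U f b) (hc : IsConstantOnFlowCurves U f c)
    {x : EuclideanSpace ℝ (Fin n)} (hx : x ∈ U) :
    fderiv ℝ u x (∇ f x) = ‖∇ f x‖ ^ 2 • b x := by
  have hxU := hU.mem_nhds hx
  obtain ⟨S, hS, τ, hτ, h⟩ :=
    ((hf.gradient_of_isOpen hU).contDiffAt hxU).exists_nhds_forall_integralCurve_mem hxU
  obtain ⟨γ, rfl, hγ⟩ := h x (mem_of_mem_nhds hS)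
  have h0 : (0 : ℝ) ∈ Ioo (-τ) τ := ⟨neg_lt_zero.2 hτ, hτ⟩
  have hd1 := (hu.differentiableAt hxU).hasFDerivAt.comp_hasDerivAt 0 (hγ 0 h0).2
  have hd2 := ((((hf.contDiffAt hxU).differentiableAt two_ne_zero).hasFDerivAt.comp_hasDerivAt 0
    (hγ 0 h0).2).smul_const (b (γ 0))).add_const (c (γ 0))
  have heq : u ∘ γ =ᶠ[𝓝 0] fun t => (f ∘ γ) t • b (γ 0) + c (γ 0) := by
    filter_upwards [Ioo_mem_nhds h0.1 h0.2] with t ht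
    simp only [Function.comp]
    rw [hform _ (hγ t ht).1, hb γ _ _ hγ t ht 0 h0, hc γ _ _ hγ t ht 0 h0]
  rw [hd1.unique (hd2.congr_of_eventuallyEq heq), ← inner_gradient_left,
    real_inner_self_eq_norm_sq]

/-- The local Lipschitz constant of `u = f b + c` is at most `|Df|`. -/
theorem localLip_le_norm_gradient {n m : ℕ} {U : Set (EuclideanSpace ℝ (Fin n))} (hU : IsOpen U)
    {u b c : EuclideanSpace ℝ (Fin n) → EuclideanSpace ℝ (Fin m)}
    {f : EuclideanSpace ℝ (Fin n) → ℝ} (hf : ContDiffOn ℝ 2 f U)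
    (hform : ∀ x ∈ U, u x = f x • b x + c x) (hbunit : ∀ x ∈ U, ‖b x‖ = 1)
    (hb : IsConstantOnFlowCurves U f b) (hc : IsConstantOnFlowCurves U f c)
    (ha : IsPrincipalDirectionField U u (fun x => ‖∇ f x‖⁻¹ • ∇ f x))
    {x : EuclideanSpace ℝ (Fin n)} (hx : x ∈ U) :
    localLip U u x ≤ ENNReal.ofReal ‖∇ f x‖ := by
  obtain ⟨hunit, μ, hμ, hspan⟩ := ha.2.2 x hx
  refine (localLip_le_of_contDiffAt (ha.1.contDiffAt (hU.mem_nhds hx))).trans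
    (ENNReal.ofReal_le_ofReal ((norm_fderiv_le_of_eigenspace_eq_span hunit hμ hspan).trans ?_))
  rw [map_smul, fderiv_apply_gradient hU hf (ha.1.differentiableOn one_ne_zero) hform hb hc hx,
    norm_smul, norm_smul, hbunit x hx, norm_inv, norm_norm, norm_pow, norm_norm, mul_one, sq,
    ← mul_assoc]
  exact mul_le_of_le_one_left (norm_nonneg _) (inv_mul_le_one_of_le₀ le_rfl (norm_nonneg _))

/-! ### Chains of flow arcs reaching the boundary -/

/-- A chain of related points along which `g` increases by a fixed amount, as long as it stays
in `K`, leaves `K` if `g` is bounded above along it. -/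
theorem exists_related_notMem {α : Type*} {Q : α → α → Prop} {g : α → ℝ} {K : Set α} {δ M : ℝ}
    {x : α} (hx : Q x x) (hδ : 0 < δ)
    (hstep : ∀ y ∈ K, Q x y → ∃ z, Q x z ∧ g y + δ ≤ g z)
    (hM : ∀ z, Q x z → g z ≤ M) : ∃ z, Q x z ∧ z ∉ K := by
  by_contra! hcon
  have hchain : ∀ k : ℕ, ∃ z, Q x z ∧ g x + k * δ ≤ g z := by
    intro k
    induction k with
    | zero => exact ⟨x, hx, by simp⟩
    | succ k ih =>
      obtain ⟨y, hxy, hy⟩ := ih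
      obtain ⟨z, hxz, hz⟩ := hstep y (hcon y hxy) hxy
      exact ⟨z, hxz, by push_cast; linarith⟩
  obtain ⟨k, hk⟩ := exists_nat_gt ((M - g x) / δ)
  obtain ⟨z, hxz, hz⟩ := hchain k
  rw [div_lt_iff₀ hδ] at hk
  linarith [hM z hxz]

/-- If the local Lipschitz constant of `v` is at most `lam` wherever `|Df| = lam`, then `v` changes
at most as fast as `f` along a flow curve of slope `lam`. -/
theorem IsFlowCurve.norm_sub_le {n m : ℕ} {U : Set (EuclideanSpace ℝ (Fin n))} (hU : IsOpen U)
    {f : EuclideanSpace ℝ (Fin n) → ℝ} (hf : ContDiffOn ℝ 2 f U) (hharm : IsInfinityHarmonic U f)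
    {v : EuclideanSpace ℝ (Fin n) → EuclideanSpace ℝ (Fin m)} (hv : ContinuousOn v U)
    {γ : ℝ → EuclideanSpace ℝ (Fin n)} {s t p q lam : ℝ} (hγ : IsFlowCurve U f γ s t)
    (hp : p ∈ Ioo s t) (hq : q ∈ Ioo s t) (hpq : p ≤ q) (hlam : 0 < lam)
    (hslope : ‖∇ f (γ p)‖ = lam)
    (hvL : ∀ y ∈ U, ‖∇ f y‖ = lam → localLip U v y ≤ ENNReal.ofReal lam) :
    ‖v (γ q) - v (γ p)‖ ≤ f (γ q) - f (γ p) := by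
  have hsub : Icc p q ⊆ Ioo s t := fun τ hτ => ⟨hp.1.trans_le hτ.1, hτ.2.trans_lt hq.2⟩
  have hconst : ∀ τ ∈ Icc p q, ‖∇ f (γ τ)‖ = lam := fun τ hτ =>
    (hγ.norm_gradient_eq hU hf hharm (hsub hτ) hp).trans hslope
  rw [hγ.apply_sub_apply hU hf hharm hp hq hp, hslope, sq]
  exact norm_sub_le_of_localLip_le_of_norm_deriv_le hv hpq hlam.le hlam
    (fun τ hτ => (hγ τ (hsub hτ)).1) (fun τ hτ => (hγ τ (hsub hτ)).2)
    (fun τ hτ => (hconst τ hτ).le) (fun τ hτ => hvL _ (hγ τ (hsub hτ)).1 (hconst τ hτ))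

/-- The point `y` carries the same direction `b`, offset `c` and slope `|Df|` as `x`, and `v` moves
between them by no more than the signed increment of `f`. For `σ = 1` this holds when `y`
lies downstream of `x` on a chain of flow arcs, for `σ = -1` when it lies upstream. -/
def FlowLinked {n m : ℕ} (U : Set (EuclideanSpace ℝ (Fin n)))
    (f : EuclideanSpace ℝ (Fin n) → ℝ) (b c v : EuclideanSpace ℝ (Fin n) → EuclideanSpace ℝ (Fin m))
    (σ : ℝ) (x y : EuclideanSpace ℝ (Fin n)) : Prop :=
  y ∈ U ∧ b y = b x ∧ c y = c x ∧ ‖∇ f y‖ = ‖∇ f x‖ ∧ ‖v y - v x‖ ≤ σ * (f y - f x)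

theorem FlowLinked.trans {n m : ℕ} {U : Set (EuclideanSpace ℝ (Fin n))}
    {f : EuclideanSpace ℝ (Fin n) → ℝ} {b c v : EuclideanSpace ℝ (Fin n) → EuclideanSpace ℝ (Fin m)}
    {σ : ℝ} {x y z : EuclideanSpace ℝ (Fin n)} (h : FlowLinked U f b c v σ x y)
    (h' : FlowLinked U f b c v σ y z) : FlowLinked U f b c v σ x z := by
  obtain ⟨_, hb, hc, hs, hv⟩ := h
  obtain ⟨hz, hb', hc', hs', hv'⟩ := h'
  refine ⟨hz, hb'.trans hb, hc'.trans hc, hs'.trans hs, ?_⟩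
  linarith [norm_sub_le_norm_sub_add_norm_sub (v z) (v y) (v x)]

/-- Following flow arcs downstream (`σ = 1`) or upstream (`σ = -1`) leads arbitrarily close to the
boundary: arcs starting in a compact part of `U` have a uniform duration, and each changes `f` by
a fixed amount. -/
theorem exists_flowLinked_infDist_compl_lt {n m : ℕ} {U : Set (EuclideanSpace ℝ (Fin n))}
    (hU : IsOpen U) (hUb : Bornology.IsBounded U)
    {f : EuclideanSpace ℝ (Fin n) → ℝ} (hf : ContDiffOn ℝ 2 f U) (hharm : IsInfinityHarmonic U f)
    {b c v : EuclideanSpace ℝ (Fin n) → EuclideanSpace ℝ (Fin m)}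
    (hb : IsConstantOnFlowCurves U f b) (hc : IsConstantOnFlowCurves U f c)
    (hv : ContinuousOn v U) {x : EuclideanSpace ℝ (Fin n)} (hx : x ∈ U) (hx0 : 0 < ‖∇ f x‖)
    (hvL : ∀ y ∈ U, ‖∇ f y‖ = ‖∇ f x‖ → localLip U v y ≤ ENNReal.ofReal ‖∇ f x‖)
    {M : ℝ} (hM : ∀ y ∈ U, b y = b x → c y = c x → |f y - f x| ≤ M)
    {σ : ℝ} (hσ : σ = 1 ∨ σ = -1) {ε : ℝ} (hε : 0 < ε) :
    ∃ y, FlowLinked U f b c v σ x y ∧ Metric.infDist y Uᶜ < ε := by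
  have hK : IsCompact (closure U ∩ {y | ε ≤ Metric.infDist y Uᶜ}) :=
    hUb.isCompact_closure.inter_right
      (isClosed_le continuous_const (Metric.continuous_infDist_pt _))
  have hKU : closure U ∩ {y | ε ≤ Metric.infDist y Uᶜ} ⊆ U := by
    intro y hy
    by_contra hyU
    have h1 : ε ≤ Metric.infDist y Uᶜ := hy.2
    rw [Metric.infDist_zero_of_mem hyU] at h1
    exact hε.not_ge h1
  obtain ⟨τ, hτ, harc⟩ :=
    hK.exists_forall_integralCurve_mem hU hKU (hf.gradient_of_isOpen hU)
  have hstep : ∀ y ∈ closure U ∩ {y | ε ≤ Metric.infDist y Uᶜ}, FlowLinked U f b c v σ x y →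
      ∃ z, FlowLinked U f b c v σ x z ∧ σ * f y + ‖∇ f x‖ ^ 2 * (τ / 2) ≤ σ * f z := by
    intro y hy hxy
    obtain ⟨γ, rfl, hγ⟩ := harc y hy
    have hγ : IsFlowCurve U f γ (-τ) τ := hγ
    have h0 : (0 : ℝ) ∈ Ioo (-τ) τ := ⟨by linarith, hτ⟩
    have hslope := hxy.2.2.2.1
    rcases hσ with rfl | rfl
    · have h1 : τ / 2 ∈ Ioo (-τ) τ := ⟨by linarith, by linarith⟩
      have hinc := hγ.apply_sub_apply hU hf hharm h0 h1 h0
      have hvar := hγ.norm_sub_le hU hf hharm hv h0 h1 (by linarith) hx0 hslope hvL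
      rw [hslope] at hinc
      exact ⟨γ (τ / 2), hxy.trans ⟨(hγ _ h1).1, hb γ _ _ hγ _ h1 _ h0, hc γ _ _ hγ _ h1 _ h0,
        hγ.norm_gradient_eq hU hf hharm h1 h0, by linarith⟩, by linarith⟩
    · have h1 : -(τ / 2) ∈ Ioo (-τ) τ := ⟨by linarith, by linarith⟩
      have hslope' := hγ.norm_gradient_eq hU hf hharm h1 h0
      have hinc := hγ.apply_sub_apply hU hf hharm h0 h1 h0
      have hvar := hγ.norm_sub_le hU hf hharm hv h1 h0 (by linarith) hx0
        (hslope'.trans hslope) hvL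
      rw [norm_sub_rev] at hvar
      rw [hslope] at hinc
      exact ⟨γ (-(τ / 2)), hxy.trans ⟨(hγ _ h1).1, hb γ _ _ hγ _ h1 _ h0,
        hc γ _ _ hγ _ h1 _ h0, hslope', by linarith⟩, by linarith⟩
  obtain ⟨y, hxy, hy⟩ := exists_related_notMem (Q := FlowLinked U f b c v σ)
    (g := fun y => σ * f y) (M := σ * f x + M) ⟨hx, rfl, rfl, rfl, by simp⟩ (by positivity) hstep (by
      intro z hz
      have h1 := abs_le.1 (hM z hz.1 hz.2.1 hz.2.2.1)
      rcases hσ with rfl | rfl <;> linarith)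
  exact ⟨y, hxy, not_le.1 fun h => hy ⟨subset_closure hxy.1, h⟩⟩

/-- Functions that are Lipschitz on the closure of `U` and agree on the boundary are close to each
other near it. -/
theorem norm_sub_le_infDist_compl {E F : Type*} [NormedAddCommGroup E] [NormedSpace ℝ E]
    [FiniteDimensional ℝ E] [SeminormedAddCommGroup F] {U : Set E} (hU : U ≠ univ)
    {u v : E → F} {Ku Kv : ℝ≥0} (hu : LipschitzOnWith Ku u (closure U))
    (hv : LipschitzOnWith Kv v (closure U)) (huv : EqOn u v (frontier U)) {y : E} (hy : y ∈ U) :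
    ‖u y - v y‖ ≤ (Ku + Kv) * Metric.infDist y Uᶜ := by
  obtain ⟨z, hz, hd⟩ := exists_mem_frontier_infDist_compl_eq_dist hy hU
  have hzc := frontier_subset_closure hz
  have h1 := hu.norm_sub_le (subset_closure hy) hzc
  have h2 := hv.norm_sub_le (subset_closure hy) hzc
  rw [hd, dist_eq_norm, add_mul]
  have h3 := norm_sub_le (u y - u z) (v y - v z)
  rw [huv hz, sub_sub_sub_cancel_right] at h3
  rw [huv hz] at h1
  linarith

/-! ### Tightness -/

/-- If `Lv < Lu` at `x`, then the local Lipschitz constant of `v` exceeds `|Df(x)|` somewhere on the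
level of the slope `|Df|` through `x`. -/
theorem exists_norm_gradient_lt_localLip {n m : ℕ} {U : Set (EuclideanSpace ℝ (Fin n))}
    (hUo : IsOpen U) (hUb : Bornology.IsBounded U)
    {u v b c : EuclideanSpace ℝ (Fin n) → EuclideanSpace ℝ (Fin m)}
    (huLip : IsLipschitzOnClosure U u) (hvLip : IsLipschitzOnClosure U v)
    (huv : EqOn u v (frontier U))
    {f : EuclideanSpace ℝ (Fin n) → ℝ} (hform : ∀ x ∈ U, u x = f x • b x + c x)
    (hf : ContDiffOn ℝ 2 f U) (hharm : IsInfinityHarmonic U f) (hbunit : ∀ x ∈ U, ‖b x‖ = 1)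
    (hb : IsConstantOnFlowCurves U f b) (hc : IsConstantOnFlowCurves U f c)
    {x : EuclideanSpace ℝ (Fin n)} (hx : x ∈ U) (hx0 : 0 < ‖∇ f x‖)
    (hlt : localLip U v x < ENNReal.ofReal ‖∇ f x‖) :
    ∃ y ∈ U, ‖∇ f y‖ = ‖∇ f x‖ ∧ ENNReal.ofReal ‖∇ f x‖ < localLip U v y := by
  by_contra! hvL
  obtain ⟨Ku, hKu⟩ := huLip
  obtain ⟨Kv, hKv⟩ := hvLip
  have hvc : ContinuousOn v U := hKv.continuousOn.mono subset_closure
  have hne : U ≠ univ := by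
    rintro rfl
    have : Nontrivial (EuclideanSpace ℝ (Fin n)) := nontrivial_of_ne _ 0 (norm_pos_iff.1 hx0)
    exact NormedSpace.unbounded_univ ℝ (EuclideanSpace ℝ (Fin n)) hUb
  have hdiff : ∀ y ∈ U, ∀ z ∈ U, b y = b z → c y = c z → ‖u y - u z‖ = |f y - f z| := by
    intro y hy z hz hbyz hcyz
    rw [hform y hy, hform z hz, hbyz, hcyz, add_sub_add_right_eq_sub, ← sub_smul, norm_smul,
      hbunit z hz, mul_one, Real.norm_eq_abs]
  obtain ⟨D, hD⟩ := Metric.isBounded_iff.1 hUb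
  have hM : ∀ x ∈ U, ∀ y ∈ U, b y = b x → c y = c x → |f y - f x| ≤ Ku * D := by
    intro x hx y hy h1 h2
    rw [← hdiff y hy x hx h1 h2]
    refine (hKu.norm_sub_le (subset_closure hy) (subset_closure hx)).trans ?_
    rw [← dist_eq_norm]
    gcongr
    exact hD hy hx
  -- A short first arc, from `x` to `x₁`, on which `v` loses `δ` against `f`.
  obtain ⟨lam₁, hlam₁, hlam₁'⟩ := ENNReal.lt_iff_exists_nnreal_btwn.1 hlt
  rw [← ENNReal.ofReal_coe_nnreal] at hlam₁ hlam₁'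
  have hlam : (lam₁ : ℝ) < ‖∇ f x‖ := (ENNReal.ofReal_lt_ofReal_iff hx0).1 hlam₁'
  obtain ⟨ρ, hρ, hball⟩ := exists_ball_norm_sub_le_of_localLip_lt lam₁.2 hlam₁
  obtain ⟨S, hS, τ, hτ, harc⟩ := ContDiffAt.exists_nhds_forall_integralCurve_mem
    ((hf.gradient_of_isOpen hUo).contDiffAt (hUo.mem_nhds hx))
    (Filter.inter_mem (hUo.mem_nhds hx) (Metric.ball_mem_nhds x hρ))
  obtain ⟨γ, h0x, hγW⟩ := harc x (mem_of_mem_nhds hS)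
  have hγ : IsFlowCurve U f γ (-τ) τ := fun t ht => ⟨(hγW t ht).1.1, (hγW t ht).2⟩
  have h0 : (0 : ℝ) ∈ Ioo (-τ) τ := ⟨by linarith, hτ⟩
  have h1 : τ / 2 ∈ Ioo (-τ) τ := ⟨by linarith, by linarith⟩
  have hx₁ := (hγ _ h1).1
  have hbx₁ : b (γ (τ / 2)) = b x := h0x ▸ hb γ _ _ hγ _ h1 _ h0
  have hcx₁ : c (γ (τ / 2)) = c x := h0x ▸ hc γ _ _ hγ _ h1 _ h0
  have hsx₁ : ‖∇ f (γ (τ / 2))‖ = ‖∇ f x‖ := h0x ▸ hγ.norm_gradient_eq hUo hf hharm h1 h0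
  have hinc := hγ.apply_sub_apply hUo hf hharm h0 h1 h0
  have hlen : ‖γ (τ / 2) - γ 0‖ ≤ ‖∇ f x‖ * ‖τ / 2 - 0‖ :=
    (convex_Ioo (-τ) τ).norm_image_sub_le_of_norm_hasDerivWithin_le
      (fun t ht => (hγ t ht).2.hasDerivWithinAt)
      (fun t ht => (h0x ▸ hγ.norm_gradient_eq hUo hf hharm ht h0 :
        ‖∇ f (γ t)‖ = ‖∇ f x‖).le) h0 h1
  have hvx₁ := hball _ (hγW _ h1).1 _ (hγW _ h0).1
  rw [sub_zero, Real.norm_of_nonneg (by positivity)] at hlen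
  rw [h0x] at hinc hlen hvx₁
  set x₁ := γ (τ / 2)
  set δ := (‖∇ f x‖ - lam₁) * (‖∇ f x‖ * (τ / 2)) with hδ
  have hδ0 : 0 < δ := mul_pos (sub_pos.2 hlam) (by positivity)
  have hgain : ‖v x₁ - v x‖ ≤ f x₁ - f x - δ := by
    have : (lam₁ : ℝ) * ‖x₁ - x‖ ≤ lam₁ * (‖∇ f x‖ * (τ / 2)) := by gcongr
    have hloss : ‖∇ f x‖ ^ 2 * (τ / 2 - 0) - δ = lam₁ * (‖∇ f x‖ * (τ / 2)) := by rw [hδ]; ring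
    rw [hinc, hloss]
    exact hvx₁.trans this
  -- Chains of arcs from `x₁` downstream and from `x` upstream end so close to the boundary
  -- that replacing `v` by `u` at their ends costs less than `δ`.
  have hKpos : (0 : ℝ) < Ku + Kv + 1 := by positivity
  have hε : 0 < δ / (2 * (Ku + Kv + 1)) := by positivity
  obtain ⟨y, ⟨hyU, hyb, hyc, -, hyv⟩, hyd⟩ := exists_flowLinked_infDist_compl_lt hUo hUb hf hharm
    hb hc hvc hx₁ (hsx₁ ▸ hx0) (by rw [hsx₁]; exact hvL) (hM x₁ hx₁) (Or.inl rfl) hε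
  obtain ⟨z, ⟨hzU, hzb, hzc, -, hzv⟩, hzd⟩ := exists_flowLinked_infDist_compl_lt hUo hUb hf hharm
    hb hc hvc hx hx0 hvL (hM x hx) (Or.inr rfl) hε
  have hclose : ∀ w ∈ U, Metric.infDist w Uᶜ < δ / (2 * (Ku + Kv + 1)) → ‖u w - v w‖ < δ / 2 := by
    intro w hw hd
    calc ‖u w - v w‖ ≤ (Ku + Kv) * Metric.infDist w Uᶜ :=
          norm_sub_le_infDist_compl hne hKu hKv huv hw
      _ ≤ (Ku + Kv + 1) * Metric.infDist w Uᶜ :=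
          mul_le_mul_of_nonneg_right (by linarith) Metric.infDist_nonneg
      _ < (Ku + Kv + 1) * (δ / (2 * (Ku + Kv + 1))) := by gcongr
      _ = δ / 2 := by field_simp
  have hyu := hclose y hyU hyd
  have hzu := hclose z hzU hzd
  have huyz : f y - f z ≤ ‖u y - u z‖ :=
    (hdiff y hyU z hzU ((hyb.trans hbx₁).trans hzb.symm) ((hyc.trans hcx₁).trans hzc.symm)) ▸
      le_abs_self _
  have t1 := norm_sub_le_norm_sub_add_norm_sub (u y) (v y) (u z)
  have t2 := norm_sub_le_norm_sub_add_norm_sub (v y) (v z) (u z)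
  have t3 := norm_sub_le_norm_sub_add_norm_sub (v y) (v x₁) (v z)
  have t4 := norm_sub_le_norm_sub_add_norm_sub (v x₁) (v x) (v z)
  rw [norm_sub_rev (v z) (u z)] at t2
  rw [norm_sub_rev (v x) (v z)] at t4
  linarith

theorem mainTheorem5 {n m : ℕ} (U : Set (EuclideanSpace ℝ (Fin n)))
    (hUo : IsOpen U) (hUb : Bornology.IsBounded U)
    (u : EuclideanSpace ℝ (Fin n) → EuclideanSpace ℝ (Fin m))
    (hu : ContDiffOn ℝ ∞ u U) (huLip : IsLipschitzOnClosure U u)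
    (f : EuclideanSpace ℝ (Fin n) → ℝ)
    (b c : EuclideanSpace ℝ (Fin n) → EuclideanSpace ℝ (Fin m))
    (hform : ∀ x ∈ U, u x = f x • b x + c x)
    (hf : ContDiffOn ℝ ∞ f U) (hfharm : IsInfinityHarmonic U f)
    (hb : ContDiffOn ℝ ∞ b U) (hbunit : ∀ x ∈ U, ‖b x‖ = 1)
    (hbconst : IsConstantOnFlowCurves U f b)
    (hc : ContDiffOn ℝ ∞ c U) (hcconst : IsConstantOnFlowCurves U f c)
    (ha : IsPrincipalDirectionField U u (fun x => ‖∇ f x‖⁻¹ • ∇ f x)) :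
    IsTight U u := by
  refine ⟨huLip, ?_⟩
  rintro ⟨v, -, hvLip, huv, hsup⟩
  have hf2 : ContDiffOn ℝ 2 f U := contDiffOn_infty.1 hf 2
  have hLu : ∀ y ∈ U, localLip U u y ≤ ENNReal.ofReal ‖∇ f y‖ := fun y hy =>
    localLip_le_norm_gradient hUo hf2 hform hbunit hbconst hcconst ha hy
  obtain ⟨_, ⟨x, ⟨hx, hlt⟩, rfl⟩, hsupx⟩ := lt_sSup_iff.1 hsup
  have hx0 : 0 < ‖∇ f x‖ := norm_pos_iff.2 fun h => by
    have := (ha.2.2 x hx).1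
    simp [h] at this
  obtain ⟨y, hy, hslope, hyx⟩ := exists_norm_gradient_lt_localLip hUo hUb huLip hvLip huv hform hf2
    hfharm hbunit hbconst hcconst hx hx0 (hlt.trans_le (hLu x hx))
  have hyL : localLip U u y < localLip U v y := (hLu y hy).trans_lt (hslope ▸ hyx)
  have hle := le_sSup (mem_image_of_mem (localLip U v)
    (show y ∈ {x ∈ U | localLip U u x < localLip U v x} from ⟨hy, hyL⟩))
  exact (hle.trans_lt (hsupx.trans_le (hLu x hx))).not_gt hyx
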